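/- A \emph{matching graph} is a finite simple undirected graph $G=(V,E)$ with $|V|\ge 2$; write $i\sim j$ for $(i,j)\in E$ and $E(U)=\{v\in V : \exists u\in U,\ u\sim v\}$ for $U\subseteq V$. A \emph{facet} of $G$ is a non-empty set of pairwise non-adjacent vertices. Let $\mathrm{Ncond}$ be the set of probability measures $\mu$ on $V$ such that $\mu(i)>0$ for all $i\in V$ and $\mu(F)<\mu(E(F))$ for every facet $F$. The graph $G$ is \emph{separable of order} $p\ge 2$ if $V$ has a partition into $p$ facets such that any two vertices belonging to different facets are adjacent. Let $\mathcal U$ be the set of finite words over $V$ in which no two adjacent classes both occur (buffer contents, listed in order of arrival). A \emph{matching policy} is a map $\Phi:\mathcal U\times V\to\mathcal U$ such that, for all $u\in\mathcal U$ and $v\in V$: if no letter of $u$ is adjacent to $v$, then $\Phi(u,v)=uv$; otherwise $\Phi(u,v)$ is obtained from $u$ by deleting one occurrence of a letter adjacent to $v$. For a probability measure $\mu$ on $V$ with $\mu(i)>0$ for all $i$, the model $(G,\Phi,\mu)$ is \emph{stable} if the Markov chain $U_{n+1}=\Phi(U_n,v_n)$ on $\mathcal U$, with $(v_n)_{n\ge0}$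 i.i.d. of law $\mu$, is positive recurrent, that is, for every $u\in\mathcal U$ the chain started at $U_0=u$ has finite expected return time to $u$. Fix a total order on $V$. Let $[\mathcal U]=\{x\in\mathbb N^V : x_ix_j=0 \text{ whenever } i\sim j\}$, and for $u\in\mathcal U$ let $[u]\in[\mathcal U]$ count the occurrences of each letter in $u$. With $(e_i)_{i\in V}$ the canonical basis, the \emph{Match the Longest} policy is the map $\mathrm{ML}:[\mathcal U]\times V\to[\mathcal U]$ with $\mathrm{ML}(x,i)=x+e_i$ if $x_j=0$ for all $j\in E(\{i\})$, and $\mathrm{ML}(x,i)=x-e_j$ otherwise, where $j$ is the largest, in the given order, of the elements of $E(\{i\})$ at which $x$ is maximal on $E(\{i\})$. A matching policy $\Phi$ is \emph{of type} $\mathrm{ML}$ if $[\Phi(u,v)]=\mathrm{ML}([u],v)$ for all $u\in\mathcal U$, $v\in V$. \textbf{Theorem.} Let $G$ be a connected matching graph. (i) $G$ is non-bipartite if and only if there are a matching policy $\Phi$ and a $\mu\in\mathrm{Ncond}$ such that $(G,\Phi,\mu)$ is stable. (ii) If $G$ is non-bipartite, then $\mathrm{ML}$ is stable for every $\mu\in\mathrm{Ncond}$: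 the Markov chain $X_{n+1}=\mathrm{ML}(X_n,v_n)$ on $[\mathcal U]$, with $(v_n)$ i.i.d. of law $\mu$, is positive recurrent (every state has finite expected return time), and $(G,\Phi,\mu)$ is stable for every matching policy $\Phi$ of type $\mathrm{ML}$. (iii) If $G$ is separable of order $p$ for some $p\ge 3$, then $(G,\Phi,\mu)$ is stable for every matching policy $\Phi$ and every $\mu\in\mathrm{Ncond}$. -/

import Mathlib

open MeasureTheory
open scoped ENNReal

namespace MatchingModel

/-! ### Markov chains driven by an i.i.d. sequence of arrivals -/

/-- The law on `ℕ → V` of an i.i.d. sequence `(v_n)` of common law `μ`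
(the set `V` of classes carries the discrete sigma-algebra). -/
noncomputable def arrivalLaw {V : Type*} (μ : PMF V) :
    @Measure (ℕ → V) (@MeasurableSpace.pi ℕ (fun _ => V) (fun _ => ⊤)) :=
  letI : MeasurableSpace V := ⊤
  Measure.infinitePi (fun _ : ℕ => μ.toMeasure)

/-- The sequence `U_0 = u`, `U_{n+1} = f (U_n, v_n)`. -/
def trajectory {S V : Type*} (f : S → V → S) (u : S) (v : ℕ → V) : ℕ → S
  | 0 => u
  | n + 1 => f (trajectory f u v n) (v n)

/-- The first return time `inf {n ≥ 1 | U_n = u}` to `u` of the sequence started at `U_0 = u`;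
it is `∞` if there is no return. -/
noncomputable def returnTime {S V : Type*} (f : S → V → S) (u : S) (v : ℕ → V) : ℝ≥0∞ :=
  ⨅ (n : ℕ) (_ : 1 ≤ n ∧ trajectory f u v n = u), (n : ℝ≥0∞)

/-- The Markov chain `U_{n+1} = f (U_n, v_n)` on `S`, where `(v_n)` is i.i.d. of law `μ`, is
positive recurrent: for every state, the chain started there has a finite expected return time. -/
def PositiveRecurrent {S V : Type*} (f : S → V → S) (μ : PMF V) : Prop :=
  ∀ u : S,
    @lintegral (ℕ → V) (@MeasurableSpace.pi ℕ (fun _ => V) (fun _ => ⊤)) (arrivalLaw μ)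
      (fun v => returnTime f u v) < ∞

/-! ### Facets, the conditions on the arrival law, separable graphs -/

section Graph

variable {V : Type*}

/-- A facet: a non-empty set of pairwise non-adjacent vertices. -/
def IsFacet (G : SimpleGraph V) (F : Finset V) : Prop :=
  F.Nonempty ∧ ∀ i ∈ F, ∀ j ∈ F, i ≠ j → ¬ G.Adj i j

open Classical in
/-- The set of vertices that have a neighbour in `U`. -/
noncomputable def neighbors [Fintype V] (G : SimpleGraph V) (U : Finset V) : Finset V :=
  Finset.univ.filter fun v => ∃ u ∈ U, G.Adj u v

/-- The probability measures `μ` on the vertices that charge every vertex and satisfy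
`μ(F) < μ(E(F))` for every facet `F`. -/
def Ncond [Fintype V] (G : SimpleGraph V) : Set (PMF V) :=
  {μ | (∀ i, 0 < μ i) ∧
    ∀ F : Finset V, IsFacet G F → ∑ i ∈ F, μ i < ∑ i ∈ neighbors G F, μ i}

/-- The vertices can be partitioned into `p` facets, any two vertices of different facets being
adjacent. -/
def SeparableOfOrder (G : SimpleGraph V) (p : ℕ) : Prop :=
  2 ≤ p ∧ ∃ F : Fin p → Finset V,
    (∀ k, IsFacet G (F k)) ∧
    (∀ k l, k ≠ l → Disjoint (F k) (F l)) ∧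
    (∀ v, ∃ k, v ∈ F k) ∧
    ∀ k l, k ≠ l → ∀ u ∈ F k, ∀ v ∈ F l, G.Adj u v

end Graph

/-! ### Buffers and matching policies -/

section Policies

variable {V : Type*} [DecidableEq V]

/-- Buffer contents: the words over `V` (oldest item first) in which no two adjacent classes both
occur. -/
def Buffer (G : SimpleGraph V) : Type _ :=
  {u : List V // ∀ i j, G.Adj i j → u.count i * u.count j = 0}

/-- Commutative images of buffer contents. -/
def CommBuffer (G : SimpleGraph V) : Type _ :=
  {x : V → ℕ // ∀ i j, G.Adj i j → x i * x j = 0}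

/-- The commutative image of a buffer content: the number of items of each class. -/
def Buffer.comm {G : SimpleGraph V} (u : Buffer G) : CommBuffer G :=
  ⟨fun a => u.1.count a, u.2⟩

/-- A matching policy `Φ : 𝒰 × V → 𝒰`. If no item of the buffer can be matched with the arriving
item `v`, then `v` is stored, as the most recent item; otherwise `v` is not stored, and one item of
the buffer that can be matched with `v` is removed. -/
structure Policy (G : SimpleGraph V) where
  step : Buffer G → V → Buffer G
  step_store : ∀ (u : Buffer G) (v : V), (∀ j ∈ u.1, ¬ G.Adj v j) →
    (step u v).1 = u.1 ++ [v]
  step_match : ∀ (u : Buffer G) (v : V), (∃ j ∈ u.1, G.Adj v j) →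
    ∃ (w₁ : List V) (j : V) (w₂ : List V),
      G.Adj v j ∧ u.1 = w₁ ++ j :: w₂ ∧ (step u v).1 = w₁ ++ w₂

/-- The matching model `(G, Φ, μ)` is stable. -/
def Policy.Stable {G : SimpleGraph V} (Φ : Policy G) (μ : PMF V) : Prop :=
  PositiveRecurrent Φ.step μ

end Policies

/-! ### Match the Longest -/

section ML

variable {V : Type*} [Fintype V]

open Classical in
/-- The set of the neighbours `k` of `i` for which `x k` is positive and maximal among the
neighbours of `i`. -/
noncomputable def longest (G : SimpleGraph V) (x : V → ℕ) (i : V) : Finset V :=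
  Finset.univ.filter fun k => G.Adj i k ∧ 0 < x k ∧ ∀ l, G.Adj i l → x l ≤ x k

theorem longest_nonempty (G : SimpleGraph V) (x : V → ℕ) (i : V)
    (h : ¬ ∀ j, G.Adj i j → x j = 0) : (longest G x i).Nonempty := by
  classical
  push Not at h
  obtain ⟨j, hj, hx⟩ := h
  obtain ⟨k, hk, hmax⟩ := Finset.exists_max_image (Finset.univ.filter fun k => G.Adj i k) x
    ⟨j, by simpa using hj⟩
  have hk' : G.Adj i k := by simpa using hk
  have hmax' : ∀ l, G.Adj i l → x l ≤ x k := fun l hl => hmax l (by simpa using hl)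
  refine ⟨k, ?_⟩
  have := hmax' j hj
  simp only [longest, Finset.mem_filter, Finset.mem_univ, true_and]
  exact ⟨hk', by omega, hmax'⟩

variable [LinearOrder V]

open Classical in
/-- The map `(x, i) ↦ x + e_i` if no neighbour of `i` is present in `x`, and `(x, i) ↦ x - e_j`
otherwise, where `j` is the largest element of `longest G x i`. -/
noncomputable def mlCount (G : SimpleGraph V) (x : V → ℕ) (i : V) : V → ℕ :=
  if h : ∀ j, G.Adj i j → x j = 0 then x + Pi.single i 1
  else x - Pi.single ((longest G x i).max' (longest_nonempty G x i h)) 1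

theorem mlCount_mem (G : SimpleGraph V) (x : CommBuffer G) (i : V) :
    ∀ a b, G.Adj a b → mlCount G x.1 i a * mlCount G x.1 i b = 0 := by
  classical
  intro a b hab
  have h0 := x.2 a b hab
  unfold mlCount
  split_ifs with h
  · by_cases ha : a = i
    · subst ha
      have hb : b ≠ a := hab.ne'
      simp [Pi.single_eq_of_ne hb, h b hab]
    · by_cases hb : b = i
      · subst hb
        simp [Pi.single_eq_of_ne ha, h a hab.symm]
      · simpa [Pi.single_eq_of_ne ha, Pi.single_eq_of_ne hb] using h0
  · rcases Nat.mul_eq_zero.mp h0 with h1 | h1 <;> simp [h1]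

/-- The "Match the Longest" policy `ML : [𝒰] × V → [𝒰]`, with ties broken by the order of `V`. -/
noncomputable def matchLongest (G : SimpleGraph V) (x : CommBuffer G) (i : V) : CommBuffer G :=
  ⟨mlCount G x.1 i, mlCount_mem G x i⟩

/-- A matching policy on words that acts as `ML` on commutative images. -/
def Policy.IsMatchLongest {G : SimpleGraph V} (Φ : Policy G) : Prop :=
  ∀ (u : Buffer G) (v : V), (Φ.step u v).comm = matchLongest G u.comm v

end ML

end MatchingModel

/-! Stability comes from Foster's criterion `positiveRecurrent_of_drift`, applied to the chain on
words, which is irreducible through the empty buffer. Since there are finitely many facets, `Ncond`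
gives a uniform gap δ between μ(F) and μ(E(F)). For ML the Lyapunov function is the sum of squared
counts. Its one-step change is at most 1 + 2(x_i − max of x on E(i)), and slicing x into its level
sets, which are facets, bounds the mean of the bracket by −δ max x (`sum_mul_sub_maxNeighbor_le`).
The chain on counts is a surjective image of the chain on words, so it inherits recurrence. In a
separable graph a non-empty buffer lies in a single part, so the buffer length itself has drift at
most −δ under any policy. For (i), the law proportional to degrees lies in `Ncond` when the graph is
connected and non-bipartite (`sum_degree_facet_lt`), whereas in the bipartite case the two colour
classes, each containing the neighbourhood of the other, make `Ncond` empty. -/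

namespace MatchingModel

/-! ### Hitting times of chains driven by i.i.d. arrivals -/

section HittingTime

/-- The sequence with first term `a` and remaining terms `w`. -/
def consSeq {V : Type*} (a : V) (w : ℕ → V) : ℕ → V
  | 0 => a
  | n + 1 => w n

theorem consSeq_head_tail {V : Type*} (v : ℕ → V) :
    consSeq (v 0) (fun n => v (n + 1)) = v := by
  funext n
  cases n <;> rfl

/-- Checked on cylinders. Padding the index set to an initial segment turns the preimage of a
cylinder into a rectangle. -/
theorem map_consSeq_infinitePi {V : Type*} [MeasurableSpace V] (ν : Measure V)
    [IsProbabilityMeasure ν] :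
    Measurable (fun z : V × (ℕ → V) => consSeq z.1 z.2) ∧
    (ν.prod (Measure.infinitePi fun _ : ℕ => ν)).map (fun z => consSeq z.1 z.2) =
      Measure.infinitePi fun _ : ℕ => ν := by
  classical
  have hmeas : Measurable (fun z : V × (ℕ → V) => consSeq z.1 z.2) := by
    refine measurable_pi_lambda _ fun n => ?_
    cases n with
    | zero => exact measurable_fst
    | succ n => exact (measurable_pi_apply n).comp measurable_snd
  refine ⟨hmeas, Measure.eq_infinitePi _ fun s t ht => ?_⟩
  obtain ⟨N, hN⟩ : ∃ N, s ⊆ Finset.range (N + 1) :=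
    ⟨s.sup id, fun i hi => Finset.mem_range_succ_iff.2 (Finset.le_sup (f := id) hi)⟩
  set t' : ℕ → Set V := fun i => if i ∈ s then t i else Set.univ with ht'
  have hmt : ∀ i, MeasurableSet (t' i) := fun i => by
    simp only [ht']
    split_ifs with h
    · exact ht i
    · exact MeasurableSet.univ
  have hpi : Set.pi (s : Set ℕ) t = Set.pi (Finset.range (N + 1) : Set ℕ) t' := by
    ext x
    simp only [Set.mem_pi, Finset.mem_coe, ht']
    constructor
    · intro h i _
      split_ifs with hi
      · exact h i hi
      · trivial
    · intro h i hi
      simpa [hi] using h i (hN hi)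
  have hprod : ∏ i ∈ s, ν (t i) = ∏ i ∈ Finset.range (N + 1), ν (t' i) := by
    rw [← Finset.prod_subset hN]
    · exact Finset.prod_congr rfl fun i hi => by simp [ht', hi]
    · intro i _ hi
      simp [ht', hi]
  have hpre : (fun z : V × (ℕ → V) => consSeq z.1 z.2) ⁻¹'
      Set.pi (Finset.range (N + 1) : Set ℕ) t' =
      t' 0 ×ˢ Set.pi (Finset.range N : Set ℕ) (fun i => t' (i + 1)) := by
    ext ⟨a, w⟩
    simp only [Set.mem_preimage, Set.mem_pi, Finset.mem_coe, Finset.mem_range, Set.mem_prod]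
    constructor
    · intro h
      exact ⟨h 0 (by omega), fun i hi => h (i + 1) (by omega)⟩
    · rintro ⟨h0, h⟩ i hi
      cases i with
      | zero => exact h0
      | succ i => exact h i (by omega)
  rw [hpi, hprod, Measure.map_apply hmeas
    (MeasurableSet.pi (Finset.countable_toSet _) fun i _ => hmt i), hpre, Measure.prod_prod,
    Measure.infinitePi_pi _ (fun i _ => hmt (i + 1)), Finset.prod_range_succ', mul_comm]

/-- The Markov property at time 1: condition on the first arrival. -/
theorem lintegral_consSeq {V : Type*} [Fintype V] (μ : PMF V)
    (F : (ℕ → V) → ℝ≥0∞) (hF : @Measurable _ _ (@MeasurableSpace.pi ℕ (fun _ => V) (fun _ => ⊤)) _ F) :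
    @lintegral (ℕ → V) (@MeasurableSpace.pi ℕ (fun _ => V) (fun _ => ⊤)) (arrivalLaw μ) F =
      ∑ a, μ a * @lintegral (ℕ → V) (@MeasurableSpace.pi ℕ (fun _ => V) (fun _ => ⊤))
        (arrivalLaw μ) (fun w => F (consSeq a w)) := by
  let _ : MeasurableSpace V := ⊤
  have : DiscreteMeasurableSpace V := ⟨fun _ => trivial⟩
  obtain ⟨hm, hmap⟩ := map_consSeq_infinitePi μ.toMeasure
  have hlaw : arrivalLaw μ = Measure.infinitePi fun _ : ℕ => μ.toMeasure := rfl
  have h1 : ∫⁻ v, F v ∂arrivalLaw μ =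
      ∫⁻ v, F v ∂((μ.toMeasure.prod (arrivalLaw μ)).map (fun z => consSeq z.1 z.2)) := by
    rw [hlaw, hmap]
  have : IsProbabilityMeasure (arrivalLaw μ) := by rw [hlaw]; infer_instance
  rw [h1, lintegral_map hF hm, lintegral_prod (fun z : V × (ℕ → V) => F (consSeq z.1 z.2)) (hF.comp hm).aemeasurable, lintegral_fintype]
  refine Finset.sum_congr rfl fun a _ => ?_
  rw [PMF.toMeasure_apply_singleton _ _ (measurableSet_singleton a), mul_comm]

open Classical in
/-- The hitting time of `u` from `s`, truncated at `n`. -/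
noncomputable def truncHit {S V : Type*} (f : S → V → S) (u : S) : ℕ → S → (ℕ → V) → ℝ≥0∞
  | 0, _, _ => 0
  | n + 1, s, v => if s = u then 0 else 1 + truncHit f u n (f s (v 0)) (fun k => v (k + 1))

variable {S V : Type*} (f : S → V → S) (u : S)

theorem trajectory_succ' (s : S) (v : ℕ → V) (n : ℕ) :
    trajectory f s v (n + 1) = trajectory f (f s (v 0)) (fun k => v (k + 1)) n := by
  induction n with
  | zero => rfl
  | succ n ih =>
    change f (trajectory f s v (n + 1)) (v (n + 1)) = _
    rw [ih]
    rfl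

theorem truncHit_mono (n : ℕ) (s : S) (v : ℕ → V) :
    truncHit f u n s v ≤ truncHit f u (n + 1) s v := by
  induction n generalizing s v with
  | zero => exact zero_le
  | succ n ih =>
    rw [truncHit, truncHit]
    split_ifs
    · exact le_rfl
    · gcongr
      exact ih _ _

/-- Either no visit occurs before time n, or the truncated time dominates an actual visit time; an
upper bound for return times needs no more. -/
theorem truncHit_eq_or_exists (n : ℕ) (s : S) (v : ℕ → V) :
    truncHit f u n s v = n ∨
      ∃ k : ℕ, trajectory f s v k = u ∧ (k : ℝ≥0∞) ≤ truncHit f u n s v := by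
  induction n generalizing s v with
  | zero => left; simp [truncHit]
  | succ n ih =>
    by_cases hs : s = u
    · exact Or.inr ⟨0, hs, by simp⟩
    · rw [truncHit, if_neg hs]
      rcases ih (f s (v 0)) (fun k => v (k + 1)) with h | ⟨k, hk, hle⟩
      · left
        rw [h]
        push_cast
        ring
      · refine Or.inr ⟨k + 1, ?_, ?_⟩
        · rw [trajectory_succ', hk]
        · push_cast
          rw [add_comm]
          gcongr

theorem measurable_truncHit [Finite V] (n : ℕ) (s : S) :
    @Measurable _ _ (@MeasurableSpace.pi ℕ (fun _ => V) (fun _ => ⊤)) _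
      (truncHit f u n s) := by
  let _ : MeasurableSpace V := ⊤
  have : DiscreteMeasurableSpace V := ⟨fun _ => trivial⟩
  induction n generalizing s with
  | zero => exact measurable_const
  | succ n ih =>
    by_cases hs : s = u
    · have : truncHit f u (n + 1) s = fun _ => 0 := by
        funext v
        rw [truncHit, if_pos hs]
      rw [this]
      exact measurable_const
    · have : truncHit f u (n + 1) s = fun v : ℕ → V =>
          1 + truncHit f u n (f s (v 0)) (fun k => v (k + 1)) := by
        funext v
        rw [truncHit, if_neg hs]
      rw [this]
      have h2 : Measurable (fun z : V × (ℕ → V) => truncHit f u n (f s z.1) z.2) :=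
        measurable_from_prod_countable_right fun a => ih (f s a)
      exact measurable_const.add (h2.comp (Measurable.prodMk (measurable_pi_apply 0)
        (measurable_pi_lambda _ fun k => measurable_pi_apply (k + 1))))

theorem returnTime_consSeq_le (a : V) (w : ℕ → V) :
    returnTime f u (consSeq a w) ≤ 1 + ⨆ n, truncHit f u n (f u a) w := by
  by_cases h : ∃ n k : ℕ, trajectory f (f u a) w k = u ∧ (k : ℝ≥0∞) ≤ truncHit f u n (f u a) w
  · obtain ⟨n, k, hk, hle⟩ := h
    calc returnTime f u (consSeq a w) ≤ ((k + 1 : ℕ) : ℝ≥0∞) :=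
          iInf₂_le (k + 1) ⟨by omega, by rw [trajectory_succ']; exact hk⟩
      _ = 1 + (k : ℝ≥0∞) := by push_cast; ring
      _ ≤ _ := by gcongr; exact hle.trans (le_iSup (fun n => truncHit f u n (f u a) w) n)
  -- Without a visit the truncations are unbounded and the right-hand side is ∞.
  · have hn : ∀ n, truncHit f u n (f u a) w = n := fun n =>
      (truncHit_eq_or_exists f u n (f u a) w).resolve_right fun ⟨k, hk⟩ => h ⟨n, k, hk⟩
    simp [hn, ENNReal.iSup_natCast]

/-- If `W` decreases by one on average at each step away from `u`, then it bounds the expected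
hitting time of `u`. -/
theorem lintegral_truncHit_le [Fintype V] (μ : PMF V) (W : S → ℝ≥0∞)
    (hW : ∀ s, s ≠ u → ∑ a, μ a * W (f s a) + 1 ≤ W s) (n : ℕ) (s : S) :
    @lintegral (ℕ → V) (@MeasurableSpace.pi ℕ (fun _ => V) (fun _ => ⊤)) (arrivalLaw μ)
      (truncHit f u n s) ≤ W s := by
  let _ : MeasurableSpace V := ⊤
  induction n generalizing s with
  | zero => simp [truncHit]
  | succ n ih =>
    by_cases hs : s = u
    · have : truncHit f u (n + 1) s = fun _ => 0 := by
        funext v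
        rw [truncHit, if_pos hs]
      simp [this]
    · rw [lintegral_consSeq μ _ (measurable_truncHit f u (n + 1) s)]
      have hint : ∀ a, ∫⁻ w, truncHit f u (n + 1) s (consSeq a w) ∂arrivalLaw μ ≤
          1 + W (f s a) := by
        intro a
        have hw : ∀ w, truncHit f u (n + 1) s (consSeq a w) = 1 + truncHit f u n (f s a) w := by
          intro w
          rw [truncHit, if_neg hs]
          rfl
        have : IsProbabilityMeasure (arrivalLaw μ) := by unfold arrivalLaw; infer_instance
        simp only [hw]
        rw [lintegral_add_left measurable_const, lintegral_const, measure_univ, mul_one]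
        gcongr
        exact ih _
      calc _ ≤ ∑ a, μ a * (1 + W (f s a)) := by gcongr with a; exact hint a
        _ = ∑ a, μ a * W (f s a) + 1 := by
            simp only [mul_add, mul_one, Finset.sum_add_distrib]
            rw [← tsum_fintype (L := SummationFilter.unconditional V) (fun a => μ a), μ.tsum_coe,
              add_comm]
        _ ≤ W s := hW s hs

/-- The first step leaves `u`, where no drift is assumed; afterwards the truncated bounds pass to
the limit by monotone convergence. -/
theorem lintegral_returnTime_le [Fintype V] (μ : PMF V) (W : S → ℝ≥0∞)
    (hW : ∀ s, s ≠ u → ∑ a, μ a * W (f s a) + 1 ≤ W s) :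
    @lintegral (ℕ → V) (@MeasurableSpace.pi ℕ (fun _ => V) (fun _ => ⊤)) (arrivalLaw μ)
      (fun v => returnTime f u v) ≤ ∑ a, μ a * (1 + W (f u a)) := by
  let _ : MeasurableSpace V := ⊤
  have : DiscreteMeasurableSpace V := ⟨fun _ => trivial⟩
  have : IsProbabilityMeasure (arrivalLaw μ) := by unfold arrivalLaw; infer_instance
  -- A measurable majorant of the return time, which spares proving that the return time itself is
  -- measurable.
  set F : (ℕ → V) → ℝ≥0∞ :=
    fun v => 1 + ⨆ n, truncHit f u n (f u (v 0)) (fun k => v (k + 1)) with hF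
  have hFm : Measurable F := by
    have h2 : Measurable (fun z : V × (ℕ → V) => 1 + ⨆ n, truncHit f u n (f u z.1) z.2) :=
      measurable_from_prod_countable_right fun a =>
        measurable_const.add (Measurable.iSup fun n => measurable_truncHit f u n (f u a))
    exact h2.comp (Measurable.prodMk (measurable_pi_apply 0)
      (measurable_pi_lambda _ fun k => measurable_pi_apply (k + 1)))
  calc ∫⁻ v, returnTime f u v ∂arrivalLaw μ ≤ ∫⁻ v, F v ∂arrivalLaw μ := by
        refine lintegral_mono fun v => ?_
        have := returnTime_consSeq_le f u (v 0) (fun k => v (k + 1))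
        rwa [consSeq_head_tail] at this
    _ = ∑ a, μ a * ∫⁻ w, F (consSeq a w) ∂arrivalLaw μ := lintegral_consSeq μ F hFm
    _ ≤ _ := by
        gcongr with a
        change ∫⁻ w, 1 + ⨆ n, truncHit f u n (f u a) w ∂arrivalLaw μ ≤ _
        rw [lintegral_add_left measurable_const, lintegral_const, measure_univ, mul_one,
          lintegral_iSup (fun n => measurable_truncHit f u n (f u a))
            (monotone_nat_of_le_succ fun n w => truncHit_mono f u n (f u a) w)]
        gcongr
        exact iSup_le fun n => lintegral_truncHit_le f u μ W hW n (f u a)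

end HittingTime

/-! ### A drift criterion for positive recurrence -/

section Foster

theorem sum_toReal_pmf {V : Type*} [Fintype V] (μ : PMF V) : ∑ a, (μ a).toReal = 1 := by
  rw [← ENNReal.toReal_sum fun a _ => μ.apply_ne_top a,
    ← tsum_fintype (L := SummationFilter.unconditional V) (fun a => μ a), μ.tsum_coe]
  rfl

variable {S V : Type*} [Fintype V]

open Classical in
/-- The probability that the chain started at `s` does not visit `u` at times `0, …, n`. -/
noncomputable def avoidProb (f : S → V → S) (μ : PMF V) (u : S) : ℕ → S → ℝ
  | 0, s => if s = u then 0 else 1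
  | n + 1, s => if s = u then 0 else ∑ a, (μ a).toReal * avoidProb f μ u n (f s a)

variable (f : S → V → S) (μ : PMF V) (u : S)

theorem avoidProb_self (n : ℕ) : avoidProb f μ u n u = 0 := by
  cases n <;> simp [avoidProb]

theorem avoidProb_succ {s : S} (hs : s ≠ u) (n : ℕ) :
    avoidProb f μ u (n + 1) s = ∑ a, (μ a).toReal * avoidProb f μ u n (f s a) := by
  rw [avoidProb, if_neg hs]

theorem avoidProb_nonneg (n : ℕ) (s : S) : 0 ≤ avoidProb f μ u n s := by
  induction n generalizing s with
  | zero => rw [avoidProb]; split_ifs <;> norm_num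
  | succ n ih =>
    rw [avoidProb]
    split_ifs
    · exact le_rfl
    · exact Finset.sum_nonneg fun a _ => mul_nonneg ENNReal.toReal_nonneg (ih _)

theorem avoidProb_le_one (n : ℕ) (s : S) : avoidProb f μ u n s ≤ 1 := by
  induction n generalizing s with
  | zero => rw [avoidProb]; split_ifs <;> norm_num
  | succ n ih =>
    rw [avoidProb]
    split_ifs
    · exact zero_le_one
    · rw [← sum_toReal_pmf μ]
      exact Finset.sum_le_sum fun a _ => mul_le_of_le_one_right ENNReal.toReal_nonneg (ih _)

theorem avoidProb_antitone (s : S) : Antitone fun n => avoidProb f μ u n s := by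
  refine antitone_nat_of_succ_le fun n => ?_
  induction n generalizing s with
  | zero =>
    by_cases hs : s = u
    · simp [hs, avoidProb_self]
    · refine (avoidProb_le_one f μ u 1 s).trans ?_
      simp [avoidProb, hs]
  | succ n ih =>
    by_cases hs : s = u
    · simp [hs, avoidProb_self]
    · rw [avoidProb_succ f μ u hs, avoidProb_succ f μ u hs]
      exact Finset.sum_le_sum fun a _ => mul_le_mul_of_nonneg_left (ih _) ENNReal.toReal_nonneg

/-- One step of the chain, for some arrival. -/
def Step {S V : Type*} (f : S → V → S) (s t : S) : Prop := ∃ a, f s a = t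

theorem exists_avoidProb_lt_one (hμ : ∀ a, 0 < μ a) {s : S}
    (h : Relation.ReflTransGen (Step f) s u) : ∃ n, avoidProb f μ u n s < 1 := by
  induction h using Relation.ReflTransGen.head_induction_on with
  | refl => exact ⟨0, by simp [avoidProb]⟩
  | @head s t hst _ ih =>
    obtain ⟨a, rfl⟩ := hst
    obtain ⟨n, hn⟩ := ih
    by_cases hs : s = u
    · exact ⟨0, by simp [avoidProb, hs]⟩
    refine ⟨n + 1, ?_⟩
    rw [avoidProb_succ f μ u hs, ← sum_toReal_pmf μ]
    refine Finset.sum_lt_sum (fun b _ => mul_le_of_le_one_right ENNReal.toReal_nonneg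
      (avoidProb_le_one f μ u n _)) ⟨a, Finset.mem_univ a, ?_⟩
    exact mul_lt_of_lt_one_right (ENNReal.toReal_pos (hμ a).ne' (μ.apply_ne_top a)) hn

/-- Finiteness of `K` and monotonicity in time make the horizon and the hitting probability uniform.
-/
theorem exists_avoidProb_le (hμ : ∀ a, 0 < μ a)
    (hirr : ∀ s t, Relation.ReflTransGen (Step f) s t) {K : Set S} (hK : K.Finite) :
    ∃ (N : ℕ) (c : ℝ), 0 < c ∧ ∀ s ∈ K, avoidProb f μ u N s ≤ 1 - c := by
  induction K, hK using Set.Finite.induction_on with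
  | empty => exact ⟨0, 1, one_pos, by simp⟩
  | @insert a K _ _ ih =>
    obtain ⟨N, c, hc, h⟩ := ih
    obtain ⟨n, hn⟩ := exists_avoidProb_lt_one f μ u hμ (hirr a u)
    refine ⟨max N n, min c (1 - avoidProb f μ u n a), lt_min hc (by linarith), ?_⟩
    rintro s (rfl | hs)
    · have := avoidProb_antitone f μ u s (le_max_right N n)
      have := min_le_right c (1 - avoidProb f μ u n s)
      simp only at *
      linarith
    · have := avoidProb_antitone f μ u s (le_max_left N n)
      have := min_le_left c (1 - avoidProb f μ u n a)
      have := h s hs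
      simp only at *
      linarith

/-- **Foster's criterion**: an irreducible chain with a non-negative function that decreases on
average by at least `ε` at each step from outside a finite set is positive recurrent. -/
theorem positiveRecurrent_of_drift (hμ : ∀ a, 0 < μ a)
    (hirr : ∀ s t, Relation.ReflTransGen (Step f) s t) {K : Set S} (hK : K.Finite)
    (L : S → ℝ) (hL : ∀ s, 0 ≤ L s) {ε : ℝ} (hε : 0 < ε)
    (hdrift : ∀ s, s ∉ K → ∑ a, (μ a).toReal * L (f s a) ≤ L s - ε) :
    PositiveRecurrent f μ := by
  intro u
  obtain ⟨N, c, hc, hN⟩ := exists_avoidProb_le f μ u hμ hirr hK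
  obtain ⟨b, hb⟩ : ∃ b : ℝ, ∀ s ∈ K, ∑ a, (μ a).toReal * L (f s a) ≤ b :=
    (hK.image fun s => ∑ a, (μ a).toReal * L (f s a)).bddAbove.imp
      fun b hb s hs => hb ⟨s, hs, rfl⟩
  set B : ℝ := max b 0
  have hB0 : 0 ≤ B := le_max_right _ _
  -- Chosen so that C·c = 1 + B/ε. The mean of `H` drops by the probability of visiting `u` by time
  -- `N`, at least c on `K`. There C·`H` pays for the uncontrolled `L`; off `K` the drift of `L`/ε
  -- suffices.
  set C : ℝ := (1 + B / ε) / c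
  have hC : 0 ≤ C := by positivity
  set H : S → ℝ := fun s => ∑ n ∈ Finset.range N, avoidProb f μ u n s with hH
  have hH0 : ∀ s, 0 ≤ H s := fun s => Finset.sum_nonneg fun n _ => avoidProb_nonneg f μ u n s
  have hHd : ∀ s, s ≠ u →
      ∑ a, (μ a).toReal * H (f s a) = H s - 1 + avoidProb f μ u N s := by
    intro s hs
    have h1 : ∑ a, (μ a).toReal * H (f s a) =
        ∑ n ∈ Finset.range N, avoidProb f μ u (n + 1) s := by
      simp only [hH, Finset.mul_sum, avoidProb_succ f μ u hs]
      exact Finset.sum_comm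
    have h2 := Finset.sum_range_succ' (fun n => avoidProb f μ u n s) N
    rw [Finset.sum_range_succ] at h2
    have h3 : avoidProb f μ u 0 s = 1 := by simp [avoidProb, hs]
    simp only [hH]
    linarith
  set W : S → ℝ := fun s => L s / ε + C * H s with hW
  have hW0 : ∀ s, 0 ≤ W s := fun s =>
    add_nonneg (div_nonneg (hL s) hε.le) (mul_nonneg hC (hH0 s))
  have hWd : ∀ s, s ≠ u → ∑ a, (μ a).toReal * W (f s a) + 1 ≤ W s := by
    intro s hs
    have h1 : ∑ a, (μ a).toReal * W (f s a) =
        (∑ a, (μ a).toReal * L (f s a)) / ε + C * ∑ a, (μ a).toReal * H (f s a) := by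
      simp only [hW, Finset.mul_sum, Finset.sum_div, ← Finset.sum_add_distrib]
      exact Finset.sum_congr rfl fun a _ => by ring
    rw [h1, hHd s hs]
    simp only [hW]
    by_cases hsK : s ∈ K
    · have h2 : (∑ a, (μ a).toReal * L (f s a)) / ε ≤ B / ε := by
        gcongr
        exact (hb s hsK).trans (le_max_left _ _)
      have h3 : C * avoidProb f μ u N s ≤ C * (1 - c) :=
        mul_le_mul_of_nonneg_left (hN s hsK) hC
      have h4 : C * c = 1 + B / ε := div_mul_cancel₀ _ hc.ne'
      have h5 : 0 ≤ L s / ε := div_nonneg (hL s) hε.le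
      linarith
    · have h2 : (∑ a, (μ a).toReal * L (f s a)) / ε ≤ (L s - ε) / ε := by
        gcongr
        exact hdrift s hsK
      rw [sub_div, div_self hε.ne'] at h2
      have h3 : C * avoidProb f μ u N s ≤ C * 1 :=
        mul_le_mul_of_nonneg_left (avoidProb_le_one f μ u N s) hC
      linarith
  refine (lintegral_returnTime_le f u μ (fun s => ENNReal.ofReal (W s)) ?_).trans_lt ?_
  · intro s hs
    calc ∑ a, μ a * ENNReal.ofReal (W (f s a)) + 1
        = ENNReal.ofReal (∑ a, (μ a).toReal * W (f s a) + 1) := by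
          rw [ENNReal.ofReal_add (Finset.sum_nonneg fun a _ =>
            mul_nonneg ENNReal.toReal_nonneg (hW0 _)) zero_le_one, ENNReal.ofReal_one,
            ENNReal.ofReal_sum_of_nonneg fun a _ => mul_nonneg ENNReal.toReal_nonneg (hW0 _)]
          congr 1
          refine Finset.sum_congr rfl fun a _ => ?_
          rw [ENNReal.ofReal_mul ENNReal.toReal_nonneg, ENNReal.ofReal_toReal (μ.apply_ne_top a)]
      _ ≤ _ := ENNReal.ofReal_le_ofReal (hWd s hs)
  · exact ENNReal.sum_lt_top.2 fun a _ => ENNReal.mul_lt_top (μ.apply_lt_top a) (by simp)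

/-- Positive recurrence passes to the image of a chain under a surjective map. -/
theorem PositiveRecurrent.of_semiconj {S T V : Type*} {f : S → V → S} {g : T → V → T}
    {μ : PMF V} (h : PositiveRecurrent f μ) {π : S → T} (hπ : Function.Surjective π)
    (hfg : ∀ s a, π (f s a) = g (π s) a) : PositiveRecurrent g μ := by
  intro t
  obtain ⟨s, rfl⟩ := hπ t
  have htraj : ∀ v n, trajectory g (π s) v n = π (trajectory f s v n) := by
    intro v n
    induction n with
    | zero => rfl
    | succ n ih => rw [trajectory, ih, ← hfg]; rfl
  -- A return upstairs projects to a return downstairs, so the return time can only shrink.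
  refine (lintegral_mono fun v => ?_).trans_lt (h s)
  refine le_iInf₂ fun n hn => iInf₂_le n ⟨hn.1, ?_⟩
  rw [htraj, hn.2]

end Foster

/-! ### Irreducibility -/

section Irreducible

variable {V : Type*} [DecidableEq V] {G : SimpleGraph V}

/-- The empty buffer. -/
def Buffer.nil (G : SimpleGraph V) : Buffer G := ⟨[], fun _ _ _ => by simp⟩

theorem Buffer.not_adj (u : Buffer G) {i j : V} (hi : i ∈ u.1) (hj : j ∈ u.1) : ¬ G.Adj i j := by
  intro h
  rcases Nat.mul_eq_zero.1 (u.2 i j h) with h0 | h0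
  · exact List.count_eq_zero.1 h0 hi
  · exact List.count_eq_zero.1 h0 hj

theorem Policy.length_step_of_match (Φ : Policy G) (u : Buffer G) (v : V)
    (h : ∃ j ∈ u.1, G.Adj v j) : (Φ.step u v).1.length + 1 = u.1.length := by
  obtain ⟨w₁, j, w₂, _, hu, hs⟩ := Φ.step_match u v h
  rw [hu, hs]
  simp only [List.length_append, List.length_cons]
  omega

/-- An arrival adjacent to a stored letter shortens the buffer, whatever the policy removes. -/
theorem Policy.reach_nil (Φ : Policy G) (hadj : ∀ v, ∃ w, G.Adj v w) (u : Buffer G) :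
    Relation.ReflTransGen (Step Φ.step) u (Buffer.nil G) := by
  induction hn : u.1.length generalizing u with
  | zero =>
    have : u = Buffer.nil G := Subtype.ext (List.length_eq_zero_iff.1 hn)
    rw [this]
  | succ n ih =>
    obtain ⟨i, hi⟩ := List.exists_mem_of_length_pos (l := u.1) (by omega)
    obtain ⟨w, hw⟩ := hadj i
    have := Φ.length_step_of_match u w ⟨i, hi, hw.symm⟩
    exact Relation.ReflTransGen.head ⟨w, rfl⟩ (ih (Φ.step u w) (by omega))

/-- Feed in the letters of `u` in order: none can be matched, so all are stored. -/
theorem Policy.reach_of_nil (Φ : Policy G) (u : Buffer G) :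
    Relation.ReflTransGen (Step Φ.step) (Buffer.nil G) u := by
  obtain ⟨l, hl⟩ := u
  induction l using List.reverseRecOn with
  | nil => exact Relation.ReflTransGen.refl
  | append_singleton w a ih =>
    have hw : ∀ i j, G.Adj i j → w.count i * w.count j = 0 := fun i j hij =>
      Nat.le_zero.1 <| (hl i j hij) ▸ Nat.mul_le_mul
        ((List.sublist_append_left w [a]).count_le i) ((List.sublist_append_left w [a]).count_le j)
    refine (ih hw).tail ⟨a, Subtype.ext (Φ.step_store ⟨w, hw⟩ a fun j hj => ?_)⟩
    exact Buffer.not_adj ⟨w ++ [a], hl⟩ (by simp) (List.mem_append_left _ hj)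

theorem Policy.irreducible (Φ : Policy G) (hadj : ∀ v, ∃ w, G.Adj v w) (u w : Buffer G) :
    Relation.ReflTransGen (Step Φ.step) u w :=
  (Φ.reach_nil hadj u).trans (Φ.reach_of_nil w)

end Irreducible

/-! ### The conditions on the arrival law -/

section Conditions

theorem IsFacet.not_adj {V : Type*} {G : SimpleGraph V} {F : Finset V} (hF : IsFacet G F) {i j : V}
    (hi : i ∈ F) (hj : j ∈ F) : ¬ G.Adj i j := fun h => hF.2 i hi j hj h.ne h

variable {V : Type*} [Fintype V] {G : SimpleGraph V}

theorem mem_neighbors {F : Finset V} {v : V} : v ∈ neighbors G F ↔ ∃ u ∈ F, G.Adj u v := by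
  simp [neighbors]

theorem exists_gap_of_mem_Ncond {μ : PMF V} (hμ : μ ∈ Ncond G) :
    ∃ δ : ℝ, 0 < δ ∧ ∀ F, IsFacet G F →
      ∑ i ∈ F, (μ i).toReal + δ ≤ ∑ i ∈ neighbors G F, (μ i).toReal := by
  classical
  rcases isEmpty_or_nonempty {F // IsFacet G F} with h | h
  · exact ⟨1, one_pos, fun F hF => (h.false ⟨F, hF⟩).elim⟩
  · obtain ⟨⟨F₀, hF₀⟩, hmin⟩ := Finite.exists_min fun F : {F // IsFacet G F} =>
      ∑ i ∈ neighbors G F.1, (μ i).toReal - ∑ i ∈ F.1, (μ i).toReal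
    refine ⟨∑ i ∈ neighbors G F₀, (μ i).toReal - ∑ i ∈ F₀, (μ i).toReal, sub_pos.2 ?_,
      fun F hF => ?_⟩
    · rw [← ENNReal.toReal_sum fun a _ => μ.apply_ne_top a,
        ← ENNReal.toReal_sum fun a _ => μ.apply_ne_top a]
      exact ENNReal.toReal_strict_mono
        (ENNReal.sum_ne_top.2 fun a _ => μ.apply_ne_top a) (hμ.2 F₀ hF₀)
    · have := hmin ⟨F, hF⟩
      simp only at this
      linarith

theorem not_isBipartite_of_mem_Ncond (hadj : ∀ v, ∃ w, G.Adj v w) [Nonempty V] {μ : PMF V}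
    (hμ : μ ∈ Ncond G) : ¬ G.IsBipartite := by
  classical
  rintro ⟨C⟩
  have key : ∀ k l : Fin 2, k ≠ l → ∑ i with C i = k, μ i < ∑ i with C i = l, μ i := by
    intro k l hkl
    have hne : (Finset.univ.filter fun i => C i = k).Nonempty := by
      obtain ⟨v⟩ := ‹Nonempty V›
      obtain ⟨w, hw⟩ := hadj v
      have := C.valid hw
      by_cases hv : C v = k
      · exact ⟨v, by simpa using hv⟩
      · exact ⟨w, by simp only [Finset.mem_filter_univ]; omega⟩
    refine (hμ.2 (Finset.univ.filter fun i => C i = k) ⟨hne, fun i hi j hj _ hij => ?_⟩).trans_le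
      (Finset.sum_le_sum_of_subset fun j hj => ?_)
    · simp only [Finset.mem_filter_univ] at hi hj
      exact C.valid hij (hi.trans hj.symm)
    · obtain ⟨i, hi, hij⟩ := mem_neighbors.1 hj
      have := C.valid hij
      simp only [Finset.mem_filter_univ] at hi ⊢
      omega
  exact lt_asymm (key 0 1 (by decide)) (key 1 0 (by decide))

-- Double counting: the left side counts the edges leaving `F`, all of which end in E(F). Equality
-- would confine the neighbours of E(F) to `F`; by connectedness `F` and E(F) would then cover the
-- graph and 2-colour it.
open Classical in
theorem sum_degree_facet_lt (hG : G.Connected) (hb : ¬ G.IsBipartite) {F : Finset V}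
    (hF : IsFacet G F) : ∑ i ∈ F, G.degree i < ∑ i ∈ neighbors G F, G.degree i := by
  have h1 : ∑ i ∈ F, G.degree i = ∑ j ∈ neighbors G F, (F.filter fun i => G.Adj i j).card := by
    have h2 : ∀ i ∈ F, G.degree i = ((neighbors G F).filter fun j => G.Adj i j).card := by
      intro i hi
      rw [← SimpleGraph.card_neighborFinset_eq_degree]
      congr 1
      ext j
      simp only [SimpleGraph.mem_neighborFinset, Finset.mem_filter, mem_neighbors]
      exact ⟨fun h => ⟨⟨i, hi, h⟩, h⟩, fun h => h.2⟩
    rw [Finset.sum_congr rfl h2]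
    exact Finset.sum_card_bipartiteAbove_eq_sum_card_bipartiteBelow _
  have hsub : ∀ j, F.filter (fun i => G.Adj i j) ⊆ G.neighborFinset j := fun j i hi => by
    simpa [SimpleGraph.adj_comm] using (Finset.mem_filter.1 hi).2
  rw [h1]
  by_contra hlt
  have hclosed : ∀ j ∈ neighbors G F, ∀ k, G.Adj j k → k ∈ F := by
    intro j hj k hjk
    by_contra hk
    refine hlt (Finset.sum_lt_sum (fun j _ => ?_) ⟨j, hj, ?_⟩)
    · exact (Finset.card_le_card (hsub j)).trans_eq (G.card_neighborFinset_eq_degree j)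
    · rw [← SimpleGraph.card_neighborFinset_eq_degree]
      refine Finset.card_lt_card ⟨hsub j, fun h => hk ?_⟩
      exact (Finset.mem_filter.1 (h ((G.mem_neighborFinset j k).2 hjk))).1
  have hall : ∀ v, v ∈ F ∨ v ∈ neighbors G F := by
    obtain ⟨v₀, hv₀⟩ := hF.1
    intro v
    obtain ⟨p⟩ := hG.preconnected v v₀
    induction p with
    | nil => exact Or.inl hv₀
    | cons h _ ih =>
      rcases ih hv₀ with h' | h'
      · exact Or.inr (mem_neighbors.2 ⟨_, h', h.symm⟩)
      · exact Or.inl (hclosed _ h' _ h.symm)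
  refine hb ⟨SimpleGraph.Coloring.mk (fun v => if v ∈ F then (0 : Fin 2) else 1) ?_⟩
  intro v w hvw
  by_cases hv : v ∈ F <;> by_cases hw : w ∈ F
  · exact (hF.not_adj hv hw hvw).elim
  · simp [hv, hw]
  · simp [hv, hw]
  · exact (hw (hclosed v ((hall v).resolve_left hv) w hvw)).elim

theorem Ncond_nonempty (hG : G.Connected) (hadj : ∀ v, ∃ w, G.Adj v w) (hb : ¬ G.IsBipartite) :
    (Ncond G).Nonempty := by
  classical
  have hpos : ∀ v, (G.degree v : ℝ≥0∞) ≠ 0 := fun v => by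
    simpa using (G.degree_pos_iff_exists_adj v).2 (hadj v) |>.ne'
  have hsum : ∑' v, (G.degree v : ℝ≥0∞) = ∑ v, (G.degree v : ℝ≥0∞) := tsum_fintype _
  obtain ⟨v₀⟩ := hG.nonempty
  have h0 : ∑' v, (G.degree v : ℝ≥0∞) ≠ 0 := by
    rw [hsum]
    exact fun h => hpos v₀ (Finset.sum_eq_zero_iff.1 h v₀ (Finset.mem_univ _))
  have ht : ∑' v, (G.degree v : ℝ≥0∞) ≠ ∞ := by
    rw [hsum]
    exact ENNReal.sum_ne_top.2 fun v _ => ENNReal.natCast_ne_top _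
  refine ⟨PMF.normalize (fun v => (G.degree v : ℝ≥0∞)) h0 ht, fun i => ?_, fun F hF => ?_⟩
  · rw [PMF.normalize_apply]
    exact ENNReal.mul_pos (hpos i) (ENNReal.inv_ne_zero.2 ht)
  · simp only [PMF.normalize_apply, ← Finset.sum_mul]
    refine ENNReal.mul_lt_mul_left (ENNReal.inv_ne_zero.2 ht) (ENNReal.inv_ne_top.2 h0) ?_
    exact_mod_cast sum_degree_facet_lt hG hb hF

end Conditions

/-! ### Separable graphs -/

section Separable

variable {V : Type*} [Fintype V] [DecidableEq V] {G : SimpleGraph V}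

theorem Policy.stable_of_separable (Φ : Policy G) (hadj : ∀ v, ∃ w, G.Adj v w) {p : ℕ}
    (hp : SeparableOfOrder G p) {μ : PMF V} (hμ : μ ∈ Ncond G) : Φ.Stable μ := by
  obtain ⟨_, F, hF, _, hcov, hcompl⟩ := hp
  obtain ⟨δ, hδ, hgap⟩ := exists_gap_of_mem_Ncond hμ
  refine positiveRecurrent_of_drift Φ.step μ hμ.1 (Φ.irreducible hadj)
    (Set.finite_singleton (Buffer.nil G)) (fun u => (u.1.length : ℝ)) (fun u => Nat.cast_nonneg _)
    hδ fun u hu => ?_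
  obtain ⟨j, hj⟩ : ∃ j, j ∈ u.1 := List.exists_mem_of_ne_nil _ fun h => hu (Subtype.ext h)
  obtain ⟨k, hk⟩ := hcov j
  have hsub : ∀ i ∈ u.1, i ∈ F k := by
    intro i hi
    obtain ⟨l, hl⟩ := hcov i
    by_cases hkl : k = l
    · exact hkl ▸ hl
    · exact (u.not_adj hj hi (hcompl k l hkl j hk i hl)).elim
  -- An arrival outside `F k` is adjacent to everything stored, hence always matched.
  have hstep : ∀ i, ((Φ.step u i).1.length : ℝ) ≤ u.1.length +
      ((if i ∈ F k then 1 else 0) - if i ∈ neighbors G (F k) then 1 else 0) := by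
    intro i
    by_cases hi : i ∈ F k
    · have h1 : i ∉ neighbors G (F k) := fun h => by
        obtain ⟨v, hv, hvi⟩ := mem_neighbors.1 h
        exact (hF k).not_adj hv hi hvi
      rw [Φ.step_store u i fun j hj => (hF k).not_adj hi (hsub j hj), if_pos hi, if_neg h1]
      simp
    · obtain ⟨l, hl⟩ := hcov i
      have hlk : l ≠ k := fun h => hi (h ▸ hl)
      have h1 := Φ.length_step_of_match u i ⟨j, hj, hcompl l k hlk i hl j hk⟩
      have h2 : ((Φ.step u i).1.length : ℝ) + 1 = u.1.length := by exact_mod_cast h1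
      rw [if_neg hi]
      split_ifs <;> linarith
  calc ∑ i, (μ i).toReal * ((Φ.step u i).1.length : ℝ)
      ≤ ∑ i, (μ i).toReal * (u.1.length +
        ((if i ∈ F k then 1 else 0) - if i ∈ neighbors G (F k) then 1 else 0)) :=
        Finset.sum_le_sum fun i _ => mul_le_mul_of_nonneg_left (hstep i) ENNReal.toReal_nonneg
    _ = u.1.length + (∑ i ∈ F k, (μ i).toReal - ∑ i ∈ neighbors G (F k), (μ i).toReal) := by
        simp only [mul_add, mul_sub, Finset.sum_add_distrib, Finset.sum_sub_distrib, mul_ite,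
          mul_one, mul_zero, Finset.sum_ite_mem, Finset.univ_inter, ← Finset.sum_mul,
          sum_toReal_pmf, one_mul]
    _ ≤ _ := by have := hgap (F k) (hF k); linarith

end Separable

/-! ### Stability of Match the Longest -/

section MatchLongest

variable {V : Type*} [Fintype V] {G : SimpleGraph V}

theorem natCast_eq_sum_indicator {n N : ℕ} (h : n ≤ N) :
    (n : ℝ) = ∑ t ∈ Finset.Icc 1 N, if t ≤ n then (1 : ℝ) else 0 := by
  rw [Finset.sum_boole]
  have : (Finset.Icc 1 N).filter (fun t => t ≤ n) = Finset.Icc 1 n := by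
    ext t
    simp only [Finset.mem_filter, Finset.mem_Icc]
    omega
  simp [this]

open Classical in
/-- The largest value of `x` on the neighbours of `i`. -/
noncomputable def maxNeighbor (G : SimpleGraph V) (x : V → ℕ) (i : V) : ℕ :=
  (Finset.univ.filter fun j => G.Adj i j).sup x

theorem le_maxNeighbor {x : V → ℕ} {i j : V} (h : G.Adj i j) : x j ≤ maxNeighbor G x i :=
  Finset.le_sup (f := x) (by simpa using h)

theorem maxNeighbor_le {x : V → ℕ} {i : V} {m : ℕ} (h : ∀ j, G.Adj i j → x j ≤ m) :
    maxNeighbor G x i ≤ m :=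
  Finset.sup_le fun j hj => h j (by simpa using hj)

/-- Summing over the levels of `x` the inequalities for the facets `{i | t ≤ x i}`. -/
theorem sum_mul_sub_maxNeighbor_le {μ : PMF V} {δ : ℝ}
    (hgap : ∀ F, IsFacet G F →
      ∑ i ∈ F, (μ i).toReal + δ ≤ ∑ i ∈ neighbors G F, (μ i).toReal)
    {x : V → ℕ} (hx : ∀ i j, G.Adj i j → x i * x j = 0) :
    ∑ i, (μ i).toReal * ((x i : ℝ) - maxNeighbor G x i) ≤ -δ * (Finset.univ.sup x : ℕ) := by
  classical
  set N := Finset.univ.sup x with hN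
  have hle : ∀ i, x i ≤ N := fun i => Finset.le_sup (Finset.mem_univ i)
  set F : ℕ → Finset V := fun t => Finset.univ.filter fun i => t ≤ x i with hFdef
  -- Levels start at 1: at t = 0 the left side would hold even for a vertex without neighbours.
  have hM : ∀ t ∈ Finset.Icc 1 N, ∀ i, t ≤ maxNeighbor G x i ↔ i ∈ neighbors G (F t) := by
    intro t ht i
    rw [maxNeighbor, Finset.le_sup_iff (show ⊥ < t from (Finset.mem_Icc.1 ht).1), mem_neighbors]
    simp only [hFdef, Finset.mem_filter_univ]
    exact ⟨fun ⟨j, h1, h2⟩ => ⟨j, h2, h1.symm⟩, fun ⟨j, h1, h2⟩ => ⟨j, h2.symm, h1⟩⟩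
  have hfacet : ∀ t ∈ Finset.Icc 1 N, IsFacet G (F t) := by
    intro t ht
    rw [Finset.mem_Icc] at ht
    constructor
    · obtain ⟨i, -, hi⟩ := (Finset.le_sup_iff (show ⊥ < t from ht.1)).1 ht.2
      exact ⟨i, by simpa [hFdef] using hi⟩
    · intro i hi j hj _ hij
      simp only [hFdef, Finset.mem_filter_univ] at hi hj
      rcases Nat.mul_eq_zero.1 (hx i j hij) with h | h <;> omega
  have hterm : ∀ i, (μ i).toReal * ((x i : ℝ) - maxNeighbor G x i) =
      ∑ t ∈ Finset.Icc 1 N, ((if i ∈ F t then (μ i).toReal else 0) -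
        if i ∈ neighbors G (F t) then (μ i).toReal else 0) := by
    intro i
    rw [natCast_eq_sum_indicator (hle i),
      natCast_eq_sum_indicator (maxNeighbor_le fun j _ => hle j), ← Finset.sum_sub_distrib,
      Finset.mul_sum]
    refine Finset.sum_congr rfl fun t ht => ?_
    simp only [hM t ht i, hFdef, Finset.mem_filter_univ, mul_sub, mul_ite, mul_one, mul_zero]
  calc ∑ i, (μ i).toReal * ((x i : ℝ) - maxNeighbor G x i)
      = ∑ t ∈ Finset.Icc 1 N,
          (∑ i ∈ F t, (μ i).toReal - ∑ i ∈ neighbors G (F t), (μ i).toReal) := by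
        rw [Finset.sum_congr rfl fun i _ => hterm i, Finset.sum_comm]
        refine Finset.sum_congr rfl fun t _ => ?_
        rw [Finset.sum_sub_distrib, Finset.sum_ite_mem, Finset.sum_ite_mem, Finset.univ_inter,
          Finset.univ_inter]
    _ ≤ ∑ t ∈ Finset.Icc 1 N, -δ :=
        Finset.sum_le_sum fun t ht => by have := hgap (F t) (hfacet t ht); linarith
    _ = -δ * N := by simp [mul_comm]

theorem mem_longest {x : V → ℕ} {i k : V} :
    k ∈ longest G x i ↔ G.Adj i k ∧ 0 < x k ∧ ∀ l, G.Adj i l → x l ≤ x k := by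
  simp [longest]

variable [LinearOrder V]

/-- A stored item adds 2x_i + 1 and the neighbouring maximum is 0; a match adds 1 − 2x_j with x_j
that maximum, and x_i = 0. One formula covers both. -/
theorem sum_sq_mlCount_le {x : V → ℕ} (hx : ∀ i j, G.Adj i j → x i * x j = 0) (i : V) :
    ∑ a, (mlCount G x i a : ℝ) ^ 2 ≤
      ∑ a, (x a : ℝ) ^ 2 + 1 + 2 * ((x i : ℝ) - maxNeighbor G x i) := by
  by_cases h : ∀ j, G.Adj i j → x j = 0
  · have hM : maxNeighbor G x i = 0 := Nat.le_zero.1 (maxNeighbor_le fun j hj => (h j hj).le)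
    have hsq : ∀ a, (mlCount G x i a : ℝ) ^ 2 =
        (x a : ℝ) ^ 2 + if a = i then 2 * (x i : ℝ) + 1 else 0 := by
      intro a
      rw [mlCount, dif_pos h]
      by_cases ha : a = i
      · subst ha
        simp
        ring
      · simp [ha]
    rw [Finset.sum_congr rfl fun a _ => hsq a, Finset.sum_add_distrib, Finset.sum_ite_eq' , hM]
    simp only [Finset.mem_univ, if_true, Nat.cast_zero]
    linarith
  · set j := (longest G x i).max' (longest_nonempty G x i h) with hj
    obtain ⟨hij, hpos, hmax⟩ : G.Adj i j ∧ 0 < x j ∧ ∀ l, G.Adj i l → x l ≤ x j :=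
      mem_longest.1 ((longest G x i).max'_mem (longest_nonempty G x i h))
    have hM : maxNeighbor G x i = x j := le_antisymm (maxNeighbor_le hmax) (le_maxNeighbor hij)
    have hxi : x i = 0 := (Nat.mul_eq_zero.1 (hx i j hij)).resolve_right hpos.ne'
    have hsq : ∀ a, (mlCount G x i a : ℝ) ^ 2 =
        (x a : ℝ) ^ 2 + if a = j then 1 - 2 * (x j : ℝ) else 0 := by
      intro a
      rw [mlCount, dif_neg h, ← hj]
      by_cases ha : a = j
      · rw [ha, if_pos rfl, Pi.sub_apply, Pi.single_eq_same, Nat.cast_sub hpos]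
        push_cast
        ring
      · simp [ha]
    rw [Finset.sum_congr rfl fun a _ => hsq a, Finset.sum_add_distrib, Finset.sum_ite_eq', hM, hxi]
    simp only [Finset.mem_univ, if_true, Nat.cast_zero]
    linarith

theorem Policy.IsMatchLongest.count_step {Φ : Policy G} (hΦ : Φ.IsMatchLongest) (u : Buffer G)
    (i a : V) : (Φ.step u i).1.count a = mlCount G (fun b => u.1.count b) i a :=
  congrFun (congrArg Subtype.val (hΦ u i)) a

theorem finite_buffer_count_le (G : SimpleGraph V) (m : ℕ) :
    {u : Buffer G | ∀ a, u.1.count a ≤ m}.Finite := by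
  refine Set.Finite.of_finite_image
    ((List.finite_length_le V (Fintype.card V * m)).subset ?_) Subtype.val_injective.injOn
  rintro _ ⟨u, hu, rfl⟩
  change u.1.length ≤ _
  rw [← Multiset.coe_card, ← Multiset.sum_count_eq_card (s := Finset.univ) fun a _ =>
    Finset.mem_univ a]
  calc _ ≤ ∑ _a : V, m := Finset.sum_le_sum fun a _ => by simpa using hu a
    _ = _ := by simp

theorem Policy.IsMatchLongest.stable {Φ : Policy G} (hΦ : Φ.IsMatchLongest)
    (hadj : ∀ v, ∃ w, G.Adj v w) {μ : PMF V} (hμ : μ ∈ Ncond G) : Φ.Stable μ := by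
  obtain ⟨δ, hδ, hgap⟩ := exists_gap_of_mem_Ncond hμ
  -- The drift is at most 1 − 2δ max x, hence at most −1 once max x ≥ 1/δ; the exceptional set is
  -- where all counts are at most `m`.
  obtain ⟨m, hm⟩ := exists_nat_gt (1 / δ)
  refine positiveRecurrent_of_drift Φ.step μ hμ.1 (Φ.irreducible hadj)
    (finite_buffer_count_le G m) (fun u => ∑ a, (u.1.count a : ℝ) ^ 2)
    (fun u => Finset.sum_nonneg fun a _ => sq_nonneg _) one_pos fun u hu => ?_
  set x : V → ℕ := fun b => u.1.count b with hx
  have hxu : ∀ i j, G.Adj i j → x i * x j = 0 := u.2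
  have hbig : 1 ≤ δ * (Finset.univ.sup x : ℕ) := by
    simp only [Set.mem_ofPred_eq, not_forall, not_le] at hu
    obtain ⟨a, ha⟩ := hu
    have h1 : m ≤ Finset.univ.sup x := ha.le.trans (Finset.le_sup (f := x) (Finset.mem_univ a))
    have h2 : (m : ℝ) ≤ (Finset.univ.sup x : ℕ) := by exact_mod_cast h1
    rw [div_lt_iff₀ hδ] at hm
    nlinarith
  have hsum := sum_mul_sub_maxNeighbor_le hgap hxu
  calc ∑ i, (μ i).toReal * ∑ a, ((Φ.step u i).1.count a : ℝ) ^ 2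
      ≤ ∑ i, (μ i).toReal *
          (∑ a, (x a : ℝ) ^ 2 + 1 + 2 * ((x i : ℝ) - maxNeighbor G x i)) := by
        refine Finset.sum_le_sum fun i _ => mul_le_mul_of_nonneg_left ?_ ENNReal.toReal_nonneg
        simp only [hΦ.count_step]
        exact sum_sq_mlCount_le hxu i
    _ = ∑ a, (x a : ℝ) ^ 2 + 1 +
          2 * ∑ i, (μ i).toReal * ((x i : ℝ) - maxNeighbor G x i) := by
        simp only [mul_add (μ _).toReal, Finset.sum_add_distrib]
        rw [← Finset.sum_mul, sum_toReal_pmf, one_mul, ← Finset.sum_mul, sum_toReal_pmf, one_mul,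
          Finset.mul_sum]
        congr 1
        exact Finset.sum_congr rfl fun i _ => by ring
    _ ≤ _ := by linarith

open Classical in
/-- The word that `matchLongestPolicy` leaves in the buffer. -/
noncomputable def matchLongestWord (G : SimpleGraph V) (u : List V) (v : V) : List V :=
  if h : ∀ j, G.Adj v j → u.count j = 0 then u ++ [v]
  else u.erase ((longest G (fun b => u.count b) v).max' (longest_nonempty G _ v h))

theorem count_matchLongestWord (u : List V) (v a : V) :
    (matchLongestWord G u v).count a = mlCount G (fun b => u.count b) v a := by
  rw [matchLongestWord, mlCount]
  split_ifs with h
  · by_cases ha : a = v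
    · simp [ha]
    · simp [ha, Ne.symm ha]
  · set j := (longest G (fun b => u.count b) v).max' (longest_nonempty G _ v h)
    by_cases ha : a = j
    · simp [ha]
    · simp [ha, List.count_erase_of_ne ha]

/-- The policy of type `ML` that removes the oldest item of the chosen class. -/
noncomputable def matchLongestPolicy (G : SimpleGraph V) : Policy G where
  step u v := ⟨matchLongestWord G u.1 v, fun i j hij => by
    rw [count_matchLongestWord, count_matchLongestWord]
    exact mlCount_mem G u.comm v i j hij⟩
  step_store u v h := dif_pos fun j hj => List.count_eq_zero.2 fun hju => h j hju hj
  step_match u v h := by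
    obtain ⟨k, hk, hvk⟩ := h
    have hn : ¬ ∀ j, G.Adj v j → u.1.count j = 0 := fun h => List.count_eq_zero.1 (h k hvk) hk
    set j := (longest G (fun b => u.1.count b) v).max' (longest_nonempty G _ v hn) with hj
    obtain ⟨hvj, hpos, -⟩ : G.Adj v j ∧ 0 < u.1.count j ∧
        ∀ l, G.Adj v l → u.1.count l ≤ u.1.count j :=
      mem_longest.1 ((longest G (fun b => u.1.count b) v).max'_mem (longest_nonempty G _ v hn))
    obtain ⟨w₁, w₂, -, hu, he⟩ := List.exists_erase_eq (List.count_pos_iff.1 hpos)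
    exact ⟨w₁, j, w₂, hvj, hu, (dif_neg hn).trans he⟩

theorem matchLongestPolicy_isMatchLongest (G : SimpleGraph V) :
    (matchLongestPolicy G).IsMatchLongest := fun u v =>
  Subtype.ext (funext fun a => count_matchLongestWord u.1 v a)

theorem Buffer.comm_surjective (G : SimpleGraph V) :
    Function.Surjective (Buffer.comm : Buffer G → CommBuffer G) := by
  intro x
  obtain ⟨l, hl⟩ : ∃ l : List V, ∀ a, l.count a = x.1 a := by
    refine ⟨(∑ i, Multiset.replicate (x.1 i) i).toList, fun a => ?_⟩
    rw [← Multiset.coe_count, Multiset.coe_toList, Multiset.count_sum']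
    simp [Multiset.count_replicate]
  exact ⟨⟨l, fun i j hij => by rw [hl, hl]; exact x.2 i j hij⟩, Subtype.ext (funext hl)⟩

/-- Taking counts projects the word chain of `matchLongestPolicy` onto this one. -/
theorem matchLongest_positiveRecurrent (hadj : ∀ v, ∃ w, G.Adj v w) {μ : PMF V}
    (hμ : μ ∈ Ncond G) : PositiveRecurrent (matchLongest G) μ :=
  PositiveRecurrent.of_semiconj ((matchLongestPolicy_isMatchLongest G).stable hadj hμ)
    (Buffer.comm_surjective G) (matchLongestPolicy_isMatchLongest G)

end MatchLongest

end MatchingModel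

theorem mainTheorem1 {V : Type*} [Fintype V] [LinearOrder V] [Nontrivial V]
    (G : SimpleGraph V) (hG : G.Connected) :
    (¬ G.IsBipartite ↔
      ∃ Φ : MatchingModel.Policy G, ∃ μ ∈ MatchingModel.Ncond G, Φ.Stable μ) ∧
    (¬ G.IsBipartite → ∀ μ ∈ MatchingModel.Ncond G,
      MatchingModel.PositiveRecurrent (MatchingModel.matchLongest G) μ ∧
      ∀ Φ : MatchingModel.Policy G, Φ.IsMatchLongest → Φ.Stable μ) ∧
    (∀ p : ℕ, 3 ≤ p → MatchingModel.SeparableOfOrder G p →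
      ∀ Φ : MatchingModel.Policy G, ∀ μ ∈ MatchingModel.Ncond G, Φ.Stable μ) := by
  have hadj : ∀ v, ∃ w, G.Adj v w := fun v => hG.preconnected.exists_adj_of_nontrivial v
  refine ⟨⟨fun hb => ?_, ?_⟩, fun _ μ hμ => ⟨MatchingModel.matchLongest_positiveRecurrent hadj hμ,
    fun Φ hΦ => hΦ.stable hadj hμ⟩, fun p _ hp Φ μ hμ => Φ.stable_of_separable hadj hp hμ⟩
  · obtain ⟨μ, hμ⟩ := MatchingModel.Ncond_nonempty hG hadj hb
    exact ⟨MatchingModel.matchLongestPolicy G, μ, hμ,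
      (MatchingModel.matchLongestPolicy_isMatchLongest G).stable hadj hμ⟩
  · rintro ⟨Φ, μ, hμ, -⟩
    exact MatchingModel.not_isBipartite_of_mem_Ncond hadj hμ
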